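/- A \emph{product state} of $\mathbb{C}^n\otimes\mathbb{C}^m$ is a vector $a\otimes b$ with unit vectors $a\in\mathbb{C}^n$, $b\in\mathbb{C}^m$. An \emph{unextendible product basis} (UPB) of $\mathbb{C}^n\otimes\mathbb{C}^m$ is an orthonormal family of $k<nm$ product states $\phi_1,\dots,\phi_k$ such that no product state is orthogonal to all of $\phi_1,\dots,\phi_k$; its \emph{missing states number} is $nm-k$. \textbf{Theorem.} Let $n,m$ be integers with $7\le n\le m\le n+1$. Then for every integer $t$ with $4\le t\le\lfloor mn/2\rfloor+1$ there is a UPB of $\mathbb{C}^n\otimes\mathbb{C}^m$ with missing states number $t$. -/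

import Mathlib

open scoped TensorProduct

/-- The bipartite Hilbert space `ℂⁿ ⊗ ℂᵐ`; its inner product is determined by
`⟪a ⊗ b, c ⊗ d⟫ = ⟪a, c⟫ * ⟪b, d⟫`. -/
abbrev Bipartite (n m : ℕ) : Type :=
  EuclideanSpace ℂ (Fin n) ⊗[ℂ] EuclideanSpace ℂ (Fin m)

/-- A product state: a tensor product `a ⊗ b` of unit vectors. -/
def IsProductState {n m : ℕ} (ψ : Bipartite n m) : Prop :=
  ∃ (a : EuclideanSpace ℂ (Fin n)) (b : EuclideanSpace ℂ (Fin m)),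
    ‖a‖ = 1 ∧ ‖b‖ = 1 ∧ ψ = a ⊗ₜ[ℂ] b

/-- A `k`-member unextendible product basis of `ℂⁿ ⊗ ℂᵐ`. -/
structure IsUPB {n m k : ℕ} (φ : Fin k → Bipartite n m) : Prop where
  card_lt : k < n * m
  isProductState : ∀ i, IsProductState (φ i)
  orthonormal : Orthonormal ℂ φ
  unextendible : ∀ ψ : Bipartite n m, (∀ i, inner ℂ (φ i) ψ = 0) → ¬ IsProductState ψ

/-- The missing states number `nm - k` of a family of `k` states in `ℂⁿ ⊗ ℂᵐ`. It is used for
unextendible product bases only, where `k < nm`, so the subtraction does not truncate. -/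
def missingStatesNumber {n m k : ℕ} (_φ : Fin k → Bipartite n m) : ℕ := n * m - k

/-!
Stacking orthogonal product families of `ℂⁿ ⊗ ℂᵐ` and `ℂᵖ ⊗ ℂᵐ` blockwise gives one of
`ℂⁿ⁺ᵖ ⊗ ℂᵐ`; it stays unextendible, and the missing numbers add, where a complete product basis
contributes `0`. If the missing numbers of each block contain an interval that starts at `4`, has at
least three elements and reaches half of the dimension, then so do those of the sum, apart from `7`,
which the sums can leave out but which already occurs in `ℂ³ ⊗ ℂ⁵`. Hence everything built from
blocks `3 × 4`, `3 × 5`, `4 × 4` and `4 × 5` reaches half of the dimension; a strip `3 × m`, where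
the interval goes slightly further, accounts for the last `+ 1`. In a small block unextendibility is
a finite check: a product vector `x ⊗ y` orthogonal to all `aᵢ ⊗ bᵢ` splits the indices into those
with `aᵢ ⊥ x` and those with `bᵢ ⊥ y`, so it suffices that in every such splitting one of the two
sides spans its factor.
-/

open scoped InnerProductSpace Matrix

section ProductFamilies

variable {𝕜 ι κ E E' F : Type*} [RCLike 𝕜]
  [NormedAddCommGroup E] [InnerProductSpace 𝕜 E] [NormedAddCommGroup E'] [InnerProductSpace 𝕜 E']
  [NormedAddCommGroup F] [InnerProductSpace 𝕜 F]

variable (𝕜) in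
/-- The product vectors `a i ⊗ b i` are nonzero and pairwise orthogonal, and no nonzero product
vector is orthogonal to all of them. Unlike for `IsUPB`, the vectors need not be normalised and may
span the whole space, so that an orthogonal product basis is allowed too. -/
structure IsUnextendibleFamily (a : ι → E) (b : ι → F) : Prop where
  left_ne_zero : ∀ i, a i ≠ 0
  right_ne_zero : ∀ i, b i ≠ 0
  orthogonal : Pairwise fun i j => ⟪a i, a j⟫_𝕜 = 0 ∨ ⟪b i, b j⟫_𝕜 = 0
  unextendible : ∀ x y, (∀ i, ⟪a i, x⟫_𝕜 = 0 ∨ ⟪b i, y⟫_𝕜 = 0) → x = 0 ∨ y = 0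

theorem exists_inner_ne_zero_of_ne_zero [Fintype ι] (v : OrthonormalBasis ι 𝕜 E) {x : E}
    (hx : x ≠ 0) : ∃ i, ⟪v i, x⟫_𝕜 ≠ 0 := by
  contrapose! hx
  rw [← v.sum_repr' x]
  simp only [hx, zero_smul, Finset.sum_const_zero]

theorem isUnextendibleFamily_prod_orthonormalBasis [Fintype ι] [Fintype κ]
    (v : OrthonormalBasis ι 𝕜 E) (w : OrthonormalBasis κ 𝕜 F) :
    IsUnextendibleFamily 𝕜 (fun p : ι × κ => v p.1) (fun p => w p.2) where
  left_ne_zero p := v.orthonormal.ne_zero p.1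
  right_ne_zero p := w.orthonormal.ne_zero p.2
  orthogonal p q hpq := by
    by_cases h : p.1 = q.1
    · exact .inr (w.inner_eq_zero fun h' => hpq (Prod.ext h h'))
    · exact .inl (v.inner_eq_zero h)
  unextendible x y hxy := by
    by_contra! h
    obtain ⟨i, hi⟩ := exists_inner_ne_zero_of_ne_zero v h.1
    obtain ⟨j, hj⟩ := exists_inner_ne_zero_of_ne_zero w h.2
    exact (hxy (i, j)).elim hi hj

namespace IsUnextendibleFamily

variable {a : ι → E} {b : ι → F}

theorem swap (h : IsUnextendibleFamily 𝕜 a b) : IsUnextendibleFamily 𝕜 b a where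
  left_ne_zero := h.right_ne_zero
  right_ne_zero := h.left_ne_zero
  orthogonal _ _ hij := (h.orthogonal hij).symm
  unextendible x y hxy := (h.unextendible y x fun i => (hxy i).symm).symm

theorem comp_equiv (h : IsUnextendibleFamily 𝕜 a b) (e : κ ≃ ι) :
    IsUnextendibleFamily 𝕜 (a ∘ e) (b ∘ e) where
  left_ne_zero i := h.left_ne_zero (e i)
  right_ne_zero i := h.right_ne_zero (e i)
  orthogonal _ _ hij := h.orthogonal (e.injective.ne hij)
  unextendible x y hxy := h.unextendible x y (e.forall_congr_right.1 hxy)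

theorem map_left (h : IsUnextendibleFamily 𝕜 a b) (e : E ≃ₗᵢ[𝕜] E') :
    IsUnextendibleFamily 𝕜 (fun i => e (a i)) b where
  left_ne_zero i := e.map_eq_zero_iff.not.2 (h.left_ne_zero i)
  right_ne_zero := h.right_ne_zero
  orthogonal i j hij := by simpa only [e.inner_map_map] using h.orthogonal hij
  unextendible x y hxy := by
    refine (h.unextendible (e.symm x) y fun i => ?_).imp_left e.symm.map_eq_zero_iff.1
    simpa only [e.inner_map_eq_flip] using hxy i

theorem smul (h : IsUnextendibleFamily 𝕜 a b) {c d : ι → 𝕜} (hc : ∀ i, c i ≠ 0)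
    (hd : ∀ i, d i ≠ 0) : IsUnextendibleFamily 𝕜 (fun i => c i • a i) (fun i => d i • b i) where
  left_ne_zero i := smul_ne_zero (hc i) (h.left_ne_zero i)
  right_ne_zero i := smul_ne_zero (hd i) (h.right_ne_zero i)
  orthogonal i j hij := by
    simpa [inner_smul_left, inner_smul_right, hc, hd] using h.orthogonal hij
  unextendible x y hxy := h.unextendible x y (by simpa [inner_smul_left, hc, hd] using hxy)

theorem sum {a' : κ → E'} {b' : κ → F} (h : IsUnextendibleFamily 𝕜 a b)
    (h' : IsUnextendibleFamily 𝕜 a' b') :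
    IsUnextendibleFamily 𝕜
      (Sum.elim (fun i => WithLp.toLp 2 (a i, 0)) fun i => WithLp.toLp 2 (0, a' i) :
        ι ⊕ κ → WithLp 2 (E × E'))
      (Sum.elim b b') where
  left_ne_zero := by
    simpa [Prod.ext_iff] using ⟨h.left_ne_zero, h'.left_ne_zero⟩
  right_ne_zero := by simpa using ⟨h.right_ne_zero, h'.right_ne_zero⟩
  orthogonal := by
    rintro (i | i) (j | j) hij
    · simpa using h.orthogonal (by simpa using hij)
    · simp
    · simp
    · simpa using h'.orthogonal (by simpa using hij)
  unextendible x y hxy := by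
    by_contra! hne
    simp only [Sum.forall, Sum.elim_inl, Sum.elim_inr, WithLp.prod_inner_apply, inner_zero_left,
      add_zero, zero_add] at hxy
    have hfst : x.fst = 0 := (h.unextendible _ _ hxy.1).resolve_right hne.2
    have hsnd : x.snd = 0 := (h'.unextendible _ _ hxy.2).resolve_right hne.2
    exact hne.1 (WithLp.ofLp_injective 2 (Prod.ext hfst hsnd))

theorem isUPB_tmul {n m k : ℕ} {a : Fin k → EuclideanSpace ℂ (Fin n)}
    {b : Fin k → EuclideanSpace ℂ (Fin m)} (h : IsUnextendibleFamily ℂ a b)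
    (ha : ∀ i, ‖a i‖ = 1) (hb : ∀ i, ‖b i‖ = 1) (hk : k < n * m) :
    IsUPB fun i => a i ⊗ₜ[ℂ] b i where
  card_lt := hk
  isProductState i := ⟨a i, b i, ha i, hb i, rfl⟩
  orthonormal := by
    refine ⟨fun i => by rw [TensorProduct.norm_tmul, ha, hb, one_mul], fun i j hij => ?_⟩
    simpa only [TensorProduct.inner_tmul, mul_eq_zero] using h.orthogonal hij
  unextendible := by
    rintro ψ hψ ⟨x, y, hx, hy, rfl⟩
    simp only [TensorProduct.inner_tmul, mul_eq_zero] at hψ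
    rcases h.unextendible x y hψ with rfl | rfl
    · simp at hx
    · simp at hy

end IsUnextendibleFamily

end ProductFamilies

section MissingNumbers

variable {n n' m m' t : ℕ}

/-- The numbers `n * m - k` for which `ℂⁿ ⊗ ℂᵐ` has a `k`-member unextendible family of orthogonal
product vectors: the missing states numbers of its unextendible product bases, and `0`. -/
def missingNumbers (n m : ℕ) : Set ℕ :=
  {t | ∃ (k : ℕ) (a : Fin k → EuclideanSpace ℂ (Fin n)) (b : Fin k → EuclideanSpace ℂ (Fin m)),
    IsUnextendibleFamily ℂ a b ∧ k + t = n * m}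

theorem exists_isUPB_of_mem_missingNumbers (ht : 0 < t) (h : t ∈ missingNumbers n m) :
    ∃ (k : ℕ) (φ : Fin k → Bipartite n m), IsUPB φ ∧ missingStatesNumber φ = t := by
  obtain ⟨k, a, b, hab, hk⟩ := h
  have hunit := hab.smul (c := fun i => (‖a i‖⁻¹ : ℂ)) (d := fun i => (‖b i‖⁻¹ : ℂ))
    (fun i => by simpa using hab.left_ne_zero i) (fun i => by simpa using hab.right_ne_zero i)
  refine ⟨k, _, hunit.isUPB_tmul (fun i => norm_smul_inv_norm (hab.left_ne_zero i))
    (fun i => norm_smul_inv_norm (hab.right_ne_zero i)) (by omega), ?_⟩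
  rw [missingStatesNumber]
  omega

theorem IsUnextendibleFamily.mem_missingNumbers {ι : Type*} [Fintype ι]
    {a : ι → EuclideanSpace ℂ (Fin n)} {b : ι → EuclideanSpace ℂ (Fin m)}
    (h : IsUnextendibleFamily ℂ a b) (ht : Fintype.card ι + t = n * m) :
    t ∈ missingNumbers n m :=
  ⟨Fintype.card ι, _, _, h.comp_equiv (Fintype.equivFin ι).symm, ht⟩

theorem zero_mem_missingNumbers (n m : ℕ) : 0 ∈ missingNumbers n m :=
  (isUnextendibleFamily_prod_orthonormalBasis (EuclideanSpace.basisFun (Fin n) ℂ)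
    (EuclideanSpace.basisFun (Fin m) ℂ)).mem_missingNumbers (by simp)

theorem missingNumbers_comm (n m : ℕ) : missingNumbers n m = missingNumbers m n := by
  have hsub : ∀ n m, missingNumbers n m ⊆ missingNumbers m n :=
    fun n m t ⟨k, a, b, hab, hk⟩ => ⟨k, b, a, hab.swap, hk.trans (mul_comm n m)⟩
  exact (hsub n m).antisymm (hsub m n)

theorem add_mem_missingNumbers {s : ℕ} (hs : s ∈ missingNumbers n m)
    (ht : t ∈ missingNumbers n' m) : s + t ∈ missingNumbers (n + n') m := by
  obtain ⟨k, a, b, hab, hk⟩ := hs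
  obtain ⟨l, a', b', hab', hl⟩ := ht
  let e := (((EuclideanSpace.basisFun (Fin n) ℂ).prod
    (EuclideanSpace.basisFun (Fin n') ℂ)).reindex finSumFinEquiv).repr
  refine ((hab.sum hab').map_left e).mem_missingNumbers ?_
  rw [Fintype.card_sum, Fintype.card_fin, Fintype.card_fin, add_mul, ← hk, ← hl]
  ring

theorem missingNumbers_mono_left (h : n ≤ n') : missingNumbers n m ⊆ missingNumbers n' m := by
  obtain ⟨d, rfl⟩ := Nat.exists_eq_add_of_le h
  exact fun t ht => add_mem_missingNumbers ht (zero_mem_missingNumbers d m)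

theorem missingNumbers_mono (hn : n ≤ n') (hm : m ≤ m') :
    missingNumbers n m ⊆ missingNumbers n' m' := by
  refine (missingNumbers_mono_left hn).trans ?_
  rw [missingNumbers_comm n', missingNumbers_comm n']
  exact missingNumbers_mono_left hm

end MissingNumbers

section FullRank

variable {R S : Type*} [CommRing R] [DecidableEq R] {n m : ℕ}

/-- Gaussian elimination without division: whether the vectors in the list `rows` have rank `n`.
This decides the spanning condition on families of explicit vectors. -/
def hasFullRank : {n : ℕ} → List (Fin n → R) → Bool
  | 0, _ => true
  | _ + 1, rows =>
    match rows.find? fun r => r 0 ≠ 0 with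
    | none => false
    | some p => hasFullRank (rows.map fun r => p 0 • Fin.tail r - r 0 • Fin.tail p)

/-- Whether, however the pairs in the list are split between their first and second components,
the first components added to `A` or the second components added to `B` have full rank. This is the
criterion for a product vector orthogonal to all pairs not to exist; the rank tests made before the
list is exhausted prune the search. -/
def allSplitsHaveFullRank :
    List ((Fin n → R) × (Fin m → R)) → List (Fin n → R) → List (Fin m → R) → Bool
  | [], A, B => hasFullRank A || hasFullRank B
  | p :: L, A, B => hasFullRank A || hasFullRank B ||
      allSplitsHaveFullRank L (p.1 :: A) B && allSplitsHaveFullRank L A (p.2 :: B)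

variable [CommRing S] [NoZeroDivisors S] {f : R →+* S}

theorem eq_zero_of_hasFullRank (hf : Function.Injective f) :
    ∀ {n : ℕ} {rows : List (Fin n → R)} {x : Fin n → S}, hasFullRank rows →
      (∀ r ∈ rows, (f ∘ r) ⬝ᵥ x = 0) → x = 0
  | 0, _, _, _, _ => Subsingleton.elim _ _
  | n + 1, rows, x, h, hx => by
    rw [hasFullRank] at h
    split at h
    · contradiction
    rename_i p hp
    have hp0 : f (p 0) ≠ 0 := (map_ne_zero_iff f hf).2 (by simpa using List.find?_some hp)
    have hsplit : ∀ r ∈ rows, f (r 0) * x 0 + (f ∘ Fin.tail r) ⬝ᵥ Fin.tail x = 0 := fun r hr => by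
      rw [← hx r hr, dotProduct, dotProduct, Fin.sum_univ_succ]
      rfl
    have hpx := hsplit p (List.mem_of_find?_eq_some hp)
    have htail : Fin.tail x = 0 := by
      refine eq_zero_of_hasFullRank hf h (List.forall_mem_map.2 fun r hr => ?_)
      have hcomp : f ∘ (p 0 • Fin.tail r - r 0 • Fin.tail p) =
          f (p 0) • (f ∘ Fin.tail r) - f (r 0) • (f ∘ Fin.tail p) := by
        ext i
        simp
      rw [hcomp, sub_dotProduct, smul_dotProduct, smul_dotProduct, smul_eq_mul, smul_eq_mul]
      linear_combination f (p 0) * hsplit r hr - f (r 0) * hpx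
    have hhead : x 0 = 0 := by simpa [htail, hp0] using hpx
    rw [← Fin.cons_self_tail x, hhead, htail]
    exact Matrix.cons_zero_zero

theorem eq_zero_or_eq_zero_of_allSplitsHaveFullRank (hf : Function.Injective f)
    {L : List ((Fin n → R) × (Fin m → R))} {A : List (Fin n → R)} {B : List (Fin m → R)}
    {x : Fin n → S} {y : Fin m → S} (h : allSplitsHaveFullRank L A B)
    (hA : ∀ r ∈ A, (f ∘ r) ⬝ᵥ x = 0) (hB : ∀ r ∈ B, (f ∘ r) ⬝ᵥ y = 0)
    (hL : ∀ p ∈ L, (f ∘ p.1) ⬝ᵥ x = 0 ∨ (f ∘ p.2) ⬝ᵥ y = 0) : x = 0 ∨ y = 0 := by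
  induction L generalizing A B with
  | nil =>
    rw [allSplitsHaveFullRank, Bool.or_eq_true] at h
    exact h.imp (eq_zero_of_hasFullRank hf · hA) (eq_zero_of_hasFullRank hf · hB)
  | cons p L ih =>
    rw [allSplitsHaveFullRank, Bool.or_eq_true, Bool.or_eq_true, Bool.and_eq_true] at h
    rw [List.forall_mem_cons] at hL
    rcases h with (h | h) | ⟨hleft, hright⟩
    · exact .inl (eq_zero_of_hasFullRank hf h hA)
    · exact .inr (eq_zero_of_hasFullRank hf h hB)
    · rcases hL.1 with hp | hp
      · exact ih hleft (List.forall_mem_cons.2 ⟨hp, hA⟩) hB hL.2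
      · exact ih hright hA (List.forall_mem_cons.2 ⟨hp, hB⟩) hL.2

end FullRank

section IntegerVectors

variable {n m t : ℕ}

/-- The vector with integer coordinates `v`. It allows concrete families of vectors to be given by
data on which equality and orthogonality are decidable. -/
def intVec (v : Fin n → ℤ) : EuclideanSpace ℂ (Fin n) :=
  WithLp.toLp 2 (Int.castRingHom ℂ ∘ v)

theorem inner_intVec (v : Fin n → ℤ) (x : EuclideanSpace ℂ (Fin n)) :
    ⟪intVec v, x⟫_ℂ = (Int.castRingHom ℂ ∘ v) ⬝ᵥ x.ofLp := by
  simp [intVec, PiLp.inner_apply, dotProduct, mul_comm]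

theorem inner_intVec_intVec (v w : Fin n → ℤ) : ⟪intVec v, intVec w⟫_ℂ = (v ⬝ᵥ w : ℤ) := by
  rw [inner_intVec]
  simp [intVec, dotProduct]

theorem intVec_ne_zero {v : Fin n → ℤ} (hv : v ≠ 0) : intVec v ≠ 0 := by
  contrapose! hv
  ext i
  simpa [intVec] using congrFun (congrArg WithLp.ofLp hv) i

theorem mem_missingNumbers_of_list (L : List ((Fin n → ℤ) × (Fin m → ℤ)))
    (hlen : L.length + t = n * m) (hne : ∀ p ∈ L, p.1 ≠ 0 ∧ p.2 ≠ 0)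
    (horth : L.Pairwise fun p q => p.1 ⬝ᵥ q.1 = 0 ∨ p.2 ⬝ᵥ q.2 = 0)
    (hrank : allSplitsHaveFullRank L [] []) : t ∈ missingNumbers n m := by
  refine ⟨L.length, fun i => intVec (L.get i).1, fun i => intVec (L.get i).2,
    ⟨fun i => intVec_ne_zero (hne _ (L.get_mem i)).1,
      fun i => intVec_ne_zero (hne _ (L.get_mem i)).2, fun i j hij => ?_, fun x y hxy => ?_⟩, hlen⟩
  · rcases hij.lt_or_gt with h | h
    · simpa only [inner_intVec_intVec, Int.cast_eq_zero] using List.pairwise_iff_get.1 horth i j h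
    · simpa only [inner_intVec_intVec, Int.cast_eq_zero, dotProduct_comm] using
        List.pairwise_iff_get.1 horth j i h
  · refine (eq_zero_or_eq_zero_of_allSplitsHaveFullRank
      (RingHom.injective_int (Int.castRingHom ℂ)) hrank (List.forall_mem_nil _)
      (List.forall_mem_nil _) fun p hp => ?_).imp (WithLp.ofLp_injective 2 ·)
      (WithLp.ofLp_injective 2 ·)
    obtain ⟨i, rfl⟩ := List.mem_iff_get.1 hp
    simpa only [inner_intVec] using hxy i

end IntegerVectors

section SmallFamilies

-- The families below come from tilings of an `n × m` grid or from a computer search.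

theorem four_mem_missingNumbers_three_three : 4 ∈ missingNumbers 3 3 :=
  mem_missingNumbers_of_list
    [(![0, 1, -1], ![1, 0, 0]), (![0, 1, 0], ![0, 1, -1]), (![1, 0, -1], ![0, 1, 0]),
     (![1, 0, 0], ![1, 0, -1]), (![1, 1, 1], ![1, 1, 1])]
    rfl (by decide) (by decide) (by decide +kernel)

theorem five_mem_missingNumbers_three_four : 5 ∈ missingNumbers 3 4 :=
  mem_missingNumbers_of_list
    [(![0, 0, 1], ![0, 1, 0, -1]), (![0, 1, -1], ![0, 0, 1, 0]), (![0, 1, 0], ![1, 0, 0, -1]),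
     (![1, -1, 0], ![0, 1, 0, 0]), (![1, 0, -1], ![1, 0, 0, 0]), (![1, 0, 0], ![0, 0, 1, -1]),
     (![1, 1, 1], ![1, 1, 1, 1])]
    rfl (by decide) (by decide) (by decide +kernel)

theorem six_mem_missingNumbers_three_four : 6 ∈ missingNumbers 3 4 :=
  mem_missingNumbers_of_list
    [(![0, 1, -1], ![1, 0, 1, -1]), (![0, 1, 1], ![1, -1, 0, 0]), (![1, -1, 0], ![0, 0, 1, 1]),
     (![1, -1, 1], ![0, 1, 0, 0]), (![1, 1, 0], ![1, 1, -1, 0]), (![1, 1, 1], ![0, 0, 0, 1])]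
    rfl (by decide) (by decide) (by decide +kernel)

theorem seven_mem_missingNumbers_three_five : 7 ∈ missingNumbers 3 5 :=
  mem_missingNumbers_of_list
    [(![0, 0, 1], ![1, -1, 0, 0, 0]), (![0, 1, 0], ![0, 1, 0, 1, 0]),
     (![0, 1, 1], ![1, 1, -1, -1, 1]), (![1, -1, 0], ![1, 0, 1, 0, 0]),
     (![1, -1, 1], ![0, 0, 0, 0, 1]), (![1, 0, -1], ![0, 0, 0, 1, 1]),
     (![1, 0, 0], ![0, 1, 0, 0, 0]), (![1, 1, -1], ![0, 0, 1, 0, 0])]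
    rfl (by decide) (by decide) (by decide +kernel)

theorem eight_mem_missingNumbers_three_five : 8 ∈ missingNumbers 3 5 :=
  mem_missingNumbers_of_list
    [(![0, 0, 1], ![0, 1, 0, 1, 0]), (![1, -2, 2], ![1, 0, 1, 0, 0]),
     (![1, 1, 0], ![0, 0, 0, 1, 0]), (![1, 2, 2], ![1, 0, -1, 0, 1]),
     (![2, -2, 1], ![0, 1, 0, -1, 1]), (![2, 0, -1], ![0, 0, 1, 0, 0]),
     (![2, 1, 0], ![1, 1, 0, 0, -1])]
    rfl (by decide) (by decide) (by decide +kernel)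

theorem eleven_mem_missingNumbers_three_seven : 11 ∈ missingNumbers 3 7 :=
  mem_missingNumbers_of_list
    [(![1, 1, -1], ![0, 0, 0, 1, -1, 1, 1]), (![1, -1, 0], ![0, 1, 1, -1, 0, -1, 0]),
     (![1, 1, 1], ![1, 1, 0, 0, 0, 0, 0]), (![1, -1, 1], ![0, 0, 1, 1, 1, 0, 0]),
     (![1, -1, -1], ![0, 0, 0, 1, -1, -1, -1]), (![1, 0, 1], ![0, 0, 0, 0, 0, 0, 1]),
     (![0, 1, 1], ![1, -1, 1, 0, 0, 0, 0]), (![1, 1, 0], ![0, 0, 0, 0, 1, 1, 0]),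
     (![0, 1, -1], ![1, 0, 0, 0, 0, 0, 0]), (![1, 0, -1], ![0, 0, 0, 1, 1, -1, 1])]
    rfl (by decide) (by decide) (by decide +kernel)

theorem thirteen_mem_missingNumbers_three_eight : 13 ∈ missingNumbers 3 8 :=
  mem_missingNumbers_of_list
    [(![2, 1, 2], ![1, 0, -1, 0, 0, 1, -1, 0]), (![2, 1, 1], ![1, 0, 0, 0, 1, -1, 0, 0]),
     (![1, -1, -2], ![1, 0, 0, 0, -1, 0, 1, -1]), (![0, 1, 1], ![0, 0, 0, 1, 1, 1, 1, 0]),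
     (![0, 2, -1], ![1, -1, 0, 1, -1, 0, 0, 0]), (![1, 2, -2], ![0, 0, 0, 0, 0, 0, 1, 1]),
     (![1, 1, 2], ![0, 1, 0, 0, 0, 0, 0, 0]), (![0, 1, -1], ![0, 0, 1, 0, 0, 1, 0, 0]),
     (![1, -2, 0], ![1, 0, 1, 0, 1, -1, 0, 0]), (![1, 1, -1], ![0, 1, 0, 1, 0, 0, 0, 0]),
     (![2, 0, 1], ![0, 0, 0, 0, 0, 0, 0, 1])]
    rfl (by decide) (by decide) (by decide +kernel)

theorem seven_mem_missingNumbers_four_four : 7 ∈ missingNumbers 4 4 :=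
  mem_missingNumbers_of_list
    [(![0, 0, 0, 1], ![0, 1, 0, -1]), (![0, 0, 1, -1], ![0, 0, 1, 0]),
     (![0, 0, 1, 0], ![1, -1, 0, 0]), (![0, 1, 0, -1], ![1, 0, 0, 0]),
     (![0, 1, 0, 0], ![0, 0, 1, -1]), (![1, -1, 0, 0], ![0, 1, 0, 0]),
     (![1, 0, -1, 0], ![0, 0, 0, 1]), (![1, 0, 0, 0], ![1, 0, -1, 0]),
     (![1, 1, 1, 1], ![1, 1, 1, 1])]
    rfl (by decide) (by decide) (by decide +kernel)

theorem eight_mem_missingNumbers_four_four : 8 ∈ missingNumbers 4 4 :=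
  mem_missingNumbers_of_list
    [(![0, 0, 0, 1], ![1, 0, 0, 0]), (![0, 0, 1, -1], ![0, 0, 0, 1]),
     (![0, 1, 1, -1], ![0, 1, -1, 0]), (![1, -1, 0, 0], ![1, -1, -1, -1]),
     (![1, -1, 1, 0], ![1, 0, 1, 0]), (![1, 0, -1, -1], ![0, 1, 0, -1]),
     (![1, 0, 0, 0], ![1, 1, -1, 1]), (![1, 1, 0, 1], ![0, 1, 1, 0])]
    rfl (by decide) (by decide) (by decide +kernel)

theorem nine_mem_missingNumbers_four_five : 9 ∈ missingNumbers 4 5 :=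
  mem_missingNumbers_of_list
    [(![0, 0, 1, 0], ![0, 1, 0, 0, 0]), (![0, 0, 1, 0], ![1, 0, 1, 1, 1]),
     (![0, 1, 0, -1], ![0, 1, 1, 0, 0]), (![0, 1, 0, 1], ![1, -1, 0, 0, 1]),
     (![1, -1, 0, 0], ![0, 1, -1, 1, 1]), (![1, -1, 0, 1], ![1, -1, 1, 1, 1]),
     (![1, -1, 1, 1], ![0, 0, 0, 1, -1]), (![1, 0, 0, -1], ![1, 0, 0, 1, -1]),
     (![1, 1, -1, 1], ![1, 0, -1, 1, -1]), (![1, 1, -1, 1], ![1, 0, 1, -1, -1]),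
     (![1, 1, 1, -1], ![1, 0, 0, -1, 0])]
    rfl (by decide) (by decide) (by decide +kernel)

theorem ten_mem_missingNumbers_four_five : 10 ∈ missingNumbers 4 5 :=
  mem_missingNumbers_of_list
    [(![0, 0, 0, 1], ![0, 1, 0, 1, 0]), (![0, 0, 1, -1], ![1, 1, 0, -1, -1]),
     (![0, 1, -1, -1], ![0, 0, 1, 0, -1]), (![0, 1, -1, 0], ![0, 1, 0, 1, 0]),
     (![0, 1, 1, -1], ![1, 0, 1, 0, 1]), (![1, -1, 0, -1], ![0, 0, 1, 0, 0]),
     (![1, 0, -1, -1], ![1, 0, 0, 0, 0]), (![1, 0, 0, 0], ![0, 1, 0, 0, 1]),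
     (![1, 0, 1, 1], ![0, 1, -1, -1, -1]), (![1, 1, 1, 0], ![1, 0, -1, 1, 0])]
    rfl (by decide) (by decide) (by decide +kernel)

end SmallFamilies

section Intervals

open Set

variable {n n' m m' S T e e' : ℕ}

theorem Icc_subset_missingNumbers_add (hS : 6 ≤ S) (hn : Icc 4 S ⊆ missingNumbers n m)
    (hn' : Icc 4 T ⊆ missingNumbers n' m) (hT : 4 ≤ T) (h7 : 7 ∈ missingNumbers (n + n') m) :
    Icc 4 (S + T) ⊆ missingNumbers (n + n') m := by
  rintro t ⟨ht, htST⟩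
  rcases le_or_gt t S with htS | htS
  · exact missingNumbers_mono_left le_self_add (hn ⟨ht, htS⟩)
  obtain rfl | ht7 := eq_or_ne t 7
  · exact h7
  -- From `S < t` and `t ≠ 7` follows `8 ≤ t`, so both summands can be at least `4`.
  obtain ⟨s, u, rfl, hs, hu⟩ : ∃ s u, s + u = t ∧ s ∈ Icc 4 S ∧ u ∈ Icc 4 T :=
    ⟨t - min T (t - 4), min T (t - 4), by grind, by grind, by grind⟩
  exact add_mem_missingNumbers (hn hs) (hn' hu)

theorem seven_mem_missingNumbers (hn : 5 ≤ n) (hm : 3 ≤ m) : 7 ∈ missingNumbers n m := by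
  rw [missingNumbers_comm]
  exact missingNumbers_mono hm hn seven_mem_missingNumbers_three_five

/-- All missing numbers from `4` to at least `(n * m + e) / 2` occur in `ℂⁿ ⊗ ℂᵐ`. For `e = 0` the
interval reaches half of the dimension, and `e` is the excess beyond that: unlike a bound
that is rounded to an integer, it is additive when blocks are put together. At least `4`, `5` and
`6` have to occur, so that sums of two such intervals leave out only `7`. -/
def CoversHalf (e n m : ℕ) : Prop :=
  ∃ T, 6 ≤ T ∧ n * m + e ≤ 2 * T ∧ Icc 4 T ⊆ missingNumbers n m

namespace CoversHalf

theorem mono_excess (h : CoversHalf e n m) (he : e' ≤ e) : CoversHalf e' n m := by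
  obtain ⟨T, hT, hle, hsub⟩ := h
  exact ⟨T, hT, by omega, hsub⟩

theorem swap (h : CoversHalf e n m) : CoversHalf e m n := by
  rwa [CoversHalf, mul_comm, missingNumbers_comm]

theorem add_left (h : CoversHalf e n m) (h' : CoversHalf e' n' m) (hn : 5 ≤ n + n')
    (hm : 3 ≤ m) : CoversHalf (e + e') (n + n') m := by
  obtain ⟨S, hS, hSle, hSsub⟩ := h
  obtain ⟨T, hT, hTle, hTsub⟩ := h'
  refine ⟨S + T, by omega, by linarith [add_mul n n' m], ?_⟩
  exact Icc_subset_missingNumbers_add hS hSsub hTsub (by omega) (seven_mem_missingNumbers hn hm)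

theorem add_right (h : CoversHalf e n m) (h' : CoversHalf e' n m') (hn : 3 ≤ n)
    (hm : 5 ≤ m + m') : CoversHalf (e + e') n (m + m') :=
  (h.swap.add_left h'.swap hm hn).swap

end CoversHalf

theorem coversHalf_three_four : CoversHalf 0 3 4 := by
  refine ⟨6, le_rfl, le_rfl, fun t ⟨h4, h6⟩ => ?_⟩
  interval_cases t
  · exact missingNumbers_mono le_rfl (by decide) four_mem_missingNumbers_three_three
  · exact five_mem_missingNumbers_three_four
  · exact six_mem_missingNumbers_three_four

theorem coversHalf_three_five : CoversHalf 1 3 5 := by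
  obtain ⟨T, hT, -, hsub⟩ := coversHalf_three_four
  refine ⟨8, by decide, le_rfl, fun t ⟨h4, h8⟩ => ?_⟩
  obtain h6 | rfl | rfl : t ≤ 6 ∨ t = 7 ∨ t = 8 := by omega
  · exact missingNumbers_mono le_rfl (by decide) (hsub ⟨h4, h6.trans hT⟩)
  · exact seven_mem_missingNumbers_three_five
  · exact eight_mem_missingNumbers_three_five

theorem coversHalf_four_four : CoversHalf 0 4 4 := by
  obtain ⟨T, hT, -, hsub⟩ := coversHalf_three_four
  refine ⟨8, by decide, le_rfl, fun t ⟨h4, h8⟩ => ?_⟩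
  obtain h6 | rfl | rfl : t ≤ 6 ∨ t = 7 ∨ t = 8 := by omega
  · exact missingNumbers_mono_left (by decide) (hsub ⟨h4, h6.trans hT⟩)
  · exact seven_mem_missingNumbers_four_four
  · exact eight_mem_missingNumbers_four_four

theorem coversHalf_four_five : CoversHalf 0 4 5 := by
  obtain ⟨T, -, hle, hsub⟩ := coversHalf_four_four
  refine ⟨10, by decide, le_rfl, fun t ⟨h4, h10⟩ => ?_⟩
  obtain h8 | rfl | rfl : t ≤ 8 ∨ t = 9 ∨ t = 10 := by omega
  · exact missingNumbers_mono le_rfl (by decide) (hsub ⟨h4, by omega⟩)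
  · exact nine_mem_missingNumbers_four_five
  · exact ten_mem_missingNumbers_four_five

theorem coversHalf_three_seven : CoversHalf 1 3 7 := by
  obtain ⟨T, hT, -, hsub⟩ := coversHalf_three_four
  refine ⟨11, by decide, le_rfl, fun t ⟨h4, h11⟩ => ?_⟩
  obtain rfl | h10 := h11.eq_or_lt
  · exact eleven_mem_missingNumbers_three_seven
  have hfour : Icc 4 4 ⊆ missingNumbers 3 3 := by
    simpa using four_mem_missingNumbers_three_three
  rw [missingNumbers_comm] at hfour hsub ⊢
  exact Icc_subset_missingNumbers_add hT hsub hfour le_rfl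
    (seven_mem_missingNumbers (by decide) le_rfl) ⟨h4, by omega⟩

theorem coversHalf_three_eight : CoversHalf 1 3 8 := by
  obtain ⟨T, -, hle, hsub⟩ := coversHalf_three_four.add_right coversHalf_three_four le_rfl
    (by decide)
  refine ⟨13, by decide, by decide, fun t ⟨h4, h13⟩ => ?_⟩
  obtain rfl | h12 := h13.eq_or_lt
  · exact thirteen_mem_missingNumbers_three_eight
  · exact hsub ⟨h4, by omega⟩

theorem coversHalf_three (hm : 7 ≤ m) : CoversHalf 1 3 m := by
  induction m using Nat.strong_induction_on with
  | _ m ih =>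
    obtain rfl | rfl | rfl | rfl | h11 : m = 7 ∨ m = 8 ∨ m = 9 ∨ m = 10 ∨ 11 ≤ m := by omega
    · exact coversHalf_three_seven
    · exact coversHalf_three_eight
    · exact coversHalf_three_four.add_right coversHalf_three_five le_rfl (by decide)
    · exact (coversHalf_three_five.add_right coversHalf_three_five le_rfl (by decide)).mono_excess
        (by decide)
    · obtain ⟨d, rfl⟩ := Nat.exists_eq_add_of_le' h11
      exact (ih (d + 7) (by omega) (by omega)).add_right coversHalf_three_four le_rfl (by omega)

-- Every `m ≥ 6` is a sum of threes and fours.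
theorem CoversHalf.of_three_of_four (h3 : CoversHalf 0 n 3) (h4 : CoversHalf 0 n 4) (hn : 3 ≤ n)
    (hm : 6 ≤ m) : CoversHalf 0 n m := by
  induction m using Nat.strong_induction_on with
  | _ m ih =>
    obtain rfl | rfl | rfl | h9 : m = 6 ∨ m = 7 ∨ m = 8 ∨ 9 ≤ m := by omega
    · exact h3.add_right h3 hn (by decide)
    · exact h3.add_right h4 hn (by decide)
    · exact h4.add_right h4 hn (by decide)
    · obtain ⟨d, rfl⟩ := Nat.exists_eq_add_of_le' h9
      exact (ih (d + 6) (by omega) (by omega)).add_right h3 hn (by omega)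

theorem coversHalf_zero (hn : 3 ≤ n) (hm : 7 ≤ m) : CoversHalf 0 n m := by
  have h3 : CoversHalf 0 3 m := (coversHalf_three hm).mono_excess (by decide)
  have h4 : CoversHalf 0 4 m :=
    coversHalf_three_four.swap.of_three_of_four coversHalf_four_four (by decide) (by omega)
  obtain rfl | rfl | rfl | hn6 : n = 3 ∨ n = 4 ∨ n = 5 ∨ 6 ≤ n := by omega
  · exact h3
  · exact h4
  · exact (coversHalf_three_five.swap.mono_excess (by decide)).of_three_of_four
      coversHalf_four_five.swap (by decide) (by omega)
  · exact (h3.swap.of_three_of_four h4.swap (by omega) hn6).swap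

theorem coversHalf_one (hn : 6 ≤ n) (hm : 7 ≤ m) : CoversHalf 1 n m := by
  obtain ⟨d, rfl⟩ := Nat.exists_eq_add_of_le (show 3 ≤ n by omega)
  exact (coversHalf_three hm).add_left (coversHalf_zero (by omega) hm) (by omega) (by omega)

end Intervals

theorem theorem3_general (n m : ℕ) (hn : 6 ≤ n) (hm : 7 ≤ m) (t : ℕ) (ht : 4 ≤ t)
    (ht' : t ≤ m * n / 2 + 1) :
    ∃ (k : ℕ) (φ : Fin k → Bipartite n m), IsUPB φ ∧ missingStatesNumber φ = t := by
  obtain ⟨T, -, hT, hsub⟩ := coversHalf_one hn hm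
  have htT : t ≤ T := by
    rw [mul_comm] at hT
    omega
  exact exists_isUPB_of_mem_missingNumbers (by omega) (hsub ⟨ht, htT⟩)

theorem theorem3 (n m : ℕ) (hn : 7 ≤ n) (hnm : n ≤ m) (hmn : m ≤ n + 1)
    (t : ℕ) (ht : 4 ≤ t) (ht' : t ≤ m * n / 2 + 1) :
    ∃ (k : ℕ) (φ : Fin k → Bipartite n m), IsUPB φ ∧ missingStatesNumber φ = t :=
  theorem3_general n m (by omega) (by omega) t ht ht'
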